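/- Represent a set partition of $\{1,\dots,n\}$ ($n\ge 0$) by its canonical sequence $\pi=\pi_1\pi_2\cdots\pi_n$, where $\pi_i=j$ if $i$ lies in the $j$-th block, the blocks being numbered in increasing order of their least elements; $n$ is the size of $\pi$. A partition $\pi$ contains a partition $\tau$ if the sequence $\pi$ has a subsequence order-isomorphic to $\tau$, and avoids $\tau$ otherwise; $\pi$ is non-crossing if it avoids $1212$. For partitions $\sigma$ and $\rho$, let $\sigma[\rho]$ be the partition whose sequence is $\sigma$ followed by $\rho+k$, where $k$ is the number of distinct symbols in $\sigma$ and $\rho+k$ is obtained from $\rho$ by adding $k$ to every term. A partition is connected if it cannot be written as $\sigma[\tau]$ with $\sigma$ and $\tau$ both nonempty. Every partition $\pi$ can be written as $\pi=\sigma_1[\sigma_2]\cdots[\sigma_m]$ for a unique sequence of nonempty connected partitions $\sigma_1,\dots,\sigma_m$, called the components of $\pi$. Two partitions $\alpha$ and $\alpha'$ are cc-equivalent if there is a bijection $f$ from the set of non-crossing partitions avoiding $\alpha$ to the set of non-crossing partitions avoiding $\alpha'$ such that, for every $\pi$ in its domain, $f(\pi)$ has the same size and the same number of components as $\pi$. Theorem.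 If $\sigma$ and $\rho$ are non-crossing partitions and $\sigma$ is connected, then $\sigma[\rho]$ and $\rho[\sigma]$ are cc-equivalent. -/

import Mathlib

namespace PartitionPattern

/-- The largest letter of a word (`0` for the empty word). -/
def maxLetter (w : List ℕ) : ℕ := w.foldr max 0

/-- Restricted growth functions: `w₁ = 1` and `1 ≤ w_{i+1} ≤ max (w₁, …, w_i) + 1`.
The empty word qualifies. -/
def IsRGF (w : List ℕ) : Prop :=
  ∀ (i : ℕ) (h : i < w.length), 1 ≤ w[i] ∧ w[i] ≤ maxLetter (w.take i) + 1

lemma maxLetter_append (u v : List ℕ) :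
    maxLetter (u ++ v) = max (maxLetter u) (maxLetter v) := by
  induction u with
  | nil => simp [maxLetter]
  | cons a u ih =>
    simp only [maxLetter, List.cons_append, List.foldr_cons] at ih ⊢
    rw [ih, max_assoc]

lemma isRGF_nil : IsRGF [] := by
  intro i h
  simp at h

lemma isRGF_append_singleton (u : List ℕ) (a : ℕ) :
    IsRGF (u ++ [a]) ↔ IsRGF u ∧ 1 ≤ a ∧ a ≤ maxLetter u + 1 := by
  constructor
  · intro h
    refine ⟨fun i hi => ?_, ?_⟩
    · have := h i (by simp; omega)
      rwa [List.getElem_append_left hi, List.take_append_of_le_length hi.le] at this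
    · have := h u.length (by simp)
      simpa using this
  · rintro ⟨h, ha⟩ i hi
    rcases Nat.lt_or_ge i u.length with hlt | hge
    · rw [List.getElem_append_left hlt, List.take_append_of_le_length hlt.le]
      exact h i hlt
    · have : i = u.length := by simp at hi; omega
      subst this
      simpa using ha

lemma IsRGF.left {u v : List ℕ} (h : IsRGF (u ++ v)) : IsRGF u := by
  induction v using List.reverseRecOn with
  | nil => simpa using h
  | append_singleton v a ih =>
    rw [← List.append_assoc] at h
    exact ih ((isRGF_append_singleton _ _).1 h).1

lemma IsRGF.toFinset_eq {w : List ℕ} (h : IsRGF w) :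
    w.toFinset = Finset.Icc 1 (maxLetter w) := by
  induction w using List.reverseRecOn with
  | nil => simp [maxLetter]
  | append_singleton w a ih =>
    obtain ⟨h1, h2, h3⟩ := (isRGF_append_singleton _ _).1 h
    have hm : maxLetter (w ++ [a]) = max (maxLetter w) a := by
      rw [maxLetter_append]; simp [maxLetter]
    rw [List.toFinset_append, ih h1, hm]
    ext b
    simp
    omega

lemma IsRGF.card_toFinset {w : List ℕ} (h : IsRGF w) : w.toFinset.card = maxLetter w := by
  rw [h.toFinset_eq]; simp

lemma maxLetter_map_add (k : ℕ) (v : List ℕ) :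
    max k (maxLetter (v.map (· + k))) = k + maxLetter v := by
  induction v with
  | nil => simp [maxLetter]
  | cons a v ih =>
    simp only [maxLetter, List.map_cons, List.foldr_cons] at ih ⊢
    omega

lemma maxLetter_append_map (u v : List ℕ) :
    maxLetter (u ++ v.map (· + maxLetter u)) = maxLetter u + maxLetter v := by
  rw [maxLetter_append, maxLetter_map_add]

lemma IsRGF.append {u v : List ℕ} (hu : IsRGF u) (hv : IsRGF v) :
    IsRGF (u ++ v.map (· + u.toFinset.card)) := by
  rw [hu.card_toFinset]
  induction v using List.reverseRecOn with
  | nil => simpa using hu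
  | append_singleton v a ih =>
    obtain ⟨h1, h2, h3⟩ := (isRGF_append_singleton _ _).1 hv
    rw [List.map_append, ← List.append_assoc, List.map_singleton, isRGF_append_singleton,
      maxLetter_append_map]
    exact ⟨ih h1, by omega, by omega⟩

/-- A set partition of `{1, …, n}`, given by its canonical sequential form: the `i`-th letter
of the word is `j` when `i` lies in the `j`-th block, the blocks being numbered in the order of
their least elements. The words that arise are exactly the restricted growth functions. -/
@[ext]
structure SetPartition where
  word : List ℕ
  rgf : IsRGF word

namespace SetPartition

/-- The size of a partition of `{1, …, n}` is `n`. -/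
def size (π : SetPartition) : ℕ := π.word.length

/-- The number of blocks, i.e. of distinct symbols of the canonical sequence. -/
def numBlocks (π : SetPartition) : ℕ := π.word.toFinset.card

/-- The partition of the empty set. -/
def empty : SetPartition := ⟨[], isRGF_nil⟩

/-- `π.Contains τ`: the canonical sequence of `π` has a subsequence order-isomorphic to the
canonical sequence of `τ`. -/
def Contains (π τ : SetPartition) : Prop :=
  ∃ f : Fin τ.word.length → Fin π.word.length, StrictMono f ∧
    ∀ i j, (π.word.get (f i) < π.word.get (f j) ↔ τ.word.get i < τ.word.get j) ∧
      (π.word.get (f i) > π.word.get (f j) ↔ τ.word.get i > τ.word.get j)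

/-- `π.Avoids τ`: `π` does not contain the pattern `τ`. -/
def Avoids (π τ : SetPartition) : Prop := ¬ π.Contains τ

/-- The partition `1212`, i.e. `{1, 3}, {2, 4}`. -/
def p1212 : SetPartition := ⟨[1, 2, 1, 2], by
  have h : [1, 2, 1, 2] = ((([] ++ [1]) ++ [2]) ++ [1]) ++ [2] := rfl
  rw [h]
  simp only [isRGF_append_singleton]
  simp [isRGF_nil, maxLetter]⟩

/-- A partition is non-crossing when it avoids the pattern `1212`. -/
def NonCrossing (π : SetPartition) : Prop := π.Avoids p1212

/-- The partition `σ[ρ]`: the sequence `σ` followed by the sequence `ρ + k`, where `k` is the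
number of distinct symbols of `σ`. -/
def append (σ ρ : SetPartition) : SetPartition :=
  ⟨σ.word ++ ρ.word.map (· + σ.numBlocks), σ.rgf.append ρ.rgf⟩

/-- A partition is connected if it is not of the form `σ[τ]` with `σ` and `τ` nonempty. -/
def Connected (π : SetPartition) : Prop :=
  ¬ ∃ σ τ : SetPartition, σ ≠ empty ∧ τ ≠ empty ∧ π = σ.append τ

/-- The partition `σ₁[σ₂][σ₃]⋯[σ_m]`. -/
def concat (L : List SetPartition) : SetPartition := L.foldr append empty

lemma ne_empty_iff {π : SetPartition} : π ≠ empty ↔ π.word ≠ [] := by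
  rw [Ne, SetPartition.ext_iff]; rfl

lemma append_word (σ ρ : SetPartition) :
    (σ.append ρ).word = σ.word ++ ρ.word.map (· + σ.numBlocks) := rfl

lemma numBlocks_append (σ ρ : SetPartition) :
    (σ.append ρ).numBlocks = σ.numBlocks + ρ.numBlocks := by
  have h := (σ.append ρ).rgf.card_toFinset
  rw [append_word] at h
  simp only [numBlocks, append_word] at h ⊢
  rw [h, σ.rgf.card_toFinset, ρ.rgf.card_toFinset, maxLetter_append_map]

lemma append_assoc (σ ρ τ : SetPartition) :
    (σ.append ρ).append τ = σ.append (ρ.append τ) := by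
  apply SetPartition.ext
  simp only [append_word, numBlocks_append, List.map_append, List.map_map, List.append_assoc]
  congr 3
  funext x
  simp only [Function.comp_apply]
  omega

lemma empty_append (σ : SetPartition) : empty.append σ = σ := by
  apply SetPartition.ext
  simp [append_word, empty, numBlocks]

lemma append_empty (σ : SetPartition) : σ.append empty = σ := by
  apply SetPartition.ext
  simp [append_word, empty]

lemma concat_append (L M : List SetPartition) :
    concat (L ++ M) = (concat L).append (concat M) := by
  induction L with
  | nil => simp [concat, empty_append]
  | cons a L ih =>
    simp only [concat, List.cons_append, List.foldr_cons] at ih ⊢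
    rw [ih, append_assoc]

/-- `L` is a sequence of nonempty connected partitions `σ₁, …, σ_m` such that
`π = σ₁[σ₂]⋯[σ_m]`. -/
def IsDecomposition (π : SetPartition) (L : List SetPartition) : Prop :=
  (∀ σ ∈ L, σ ≠ empty ∧ σ.Connected) ∧ π = concat L

lemma size_append (σ ρ : SetPartition) : (σ.append ρ).size = σ.size + ρ.size := by
  simp [size, append_word]

lemma size_pos {π : SetPartition} (h : π ≠ empty) : 0 < π.size :=
  List.length_pos_iff.2 (ne_empty_iff.1 h)

lemma exists_isDecomposition (π : SetPartition) : ∃ L, π.IsDecomposition L := by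
  induction hn : π.size using Nat.strong_induction_on generalizing π with
  | _ n ih =>
    by_cases he : π = empty
    · exact ⟨[], by simp, by simpa [concat] using he⟩
    by_cases hc : π.Connected
    · exact ⟨[π], by simpa using ⟨he, hc⟩, by simp [concat, append_empty]⟩
    obtain ⟨σ, τ, hσ, hτ, rfl⟩ := not_not.1 hc
    have h1 := size_pos hσ
    have h2 := size_pos hτ
    rw [size_append] at hn
    obtain ⟨L, hL, hL'⟩ := ih σ.size (by omega) σ rfl
    obtain ⟨M, hM, hM'⟩ := ih τ.size (by omega) τ rfl
    refine ⟨L ++ M, ?_, ?_⟩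
    · intro x hx
      rcases List.mem_append.1 hx with hx | hx
      · exact hL x hx
      · exact hM x hx
    · rw [concat_append, ← hL', ← hM']

lemma append_left_cancel {σ ρ τ : SetPartition} (h : σ.append ρ = σ.append τ) : ρ = τ := by
  have h' := congrArg word h
  rw [append_word, append_word, List.append_cancel_left_eq] at h'
  apply SetPartition.ext
  exact List.map_injective_iff.2 (fun a b hab => by simpa using hab) h'

lemma eq_of_append_eq_aux {σ σ' ρ ρ' : SetPartition} (hσ : σ ≠ empty) (hσ' : σ'.Connected)
    {a : List ℕ} (ha : σ'.word = σ.word ++ a)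
    (ha' : ρ.word.map (· + σ.numBlocks) = a ++ ρ'.word.map (· + σ'.numBlocks)) :
    σ = σ' := by
  by_contra hne
  have hane : a ≠ [] := by
    rintro rfl
    exact hne (SetPartition.ext (by simpa using ha.symm))
  obtain ⟨x, y, hxy, hx, -⟩ := List.map_eq_append_iff.1 ha'
  have hxr : IsRGF x := by
    have := ρ.rgf
    rw [hxy] at this
    exact this.left
  refine hσ' ⟨σ, ⟨x, hxr⟩, hσ, ?_, ?_⟩
  · rw [ne_empty_iff]
    rintro rfl
    exact hane (by simpa using hx.symm)
  · apply SetPartition.ext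
    rw [append_word, ha, ← hx]

lemma eq_of_append_eq {σ σ' ρ ρ' : SetPartition} (hσ : σ ≠ empty) (hσc : σ.Connected)
    (hσ' : σ' ≠ empty) (hσc' : σ'.Connected) (h : σ.append ρ = σ'.append ρ') : σ = σ' := by
  have h' := congrArg word h
  rw [append_word, append_word] at h'
  rcases List.append_eq_append_iff.1 h' with ⟨a, h1, h2⟩ | ⟨a, h1, h2⟩
  · exact eq_of_append_eq_aux (ρ := ρ) (ρ' := ρ') hσ hσc' h1 h2
  · exact (eq_of_append_eq_aux (ρ := ρ') (ρ' := ρ) hσ' hσc h1 h2).symm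

lemma append_ne_empty {σ ρ : SetPartition} (hσ : σ ≠ empty) : σ.append ρ ≠ empty := by
  rw [ne_empty_iff] at hσ ⊢
  rw [append_word]
  simp [hσ]

/-- Every partition is `σ₁[σ₂]⋯[σ_m]` for a unique sequence of nonempty connected partitions. -/
theorem existsUnique_isDecomposition (π : SetPartition) : ∃! L, π.IsDecomposition L := by
  obtain ⟨L, hL⟩ := exists_isDecomposition π
  refine ⟨L, hL, ?_⟩
  intro M hM
  induction L generalizing π M with
  | nil =>
    cases M with
    | nil => rfl
    | cons m M =>
      exact absurd (hM.2.symm.trans hL.2) (append_ne_empty (hM.1 m (by simp)).1)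
  | cons l L ih =>
    cases M with
    | nil => exact absurd (hL.2.symm.trans hM.2) (append_ne_empty (hL.1 l (by simp)).1)
    | cons m M =>
      have h : m.append (concat M) = l.append (concat L) := hM.2.symm.trans hL.2
      obtain ⟨m1, m2⟩ := hM.1 m (by simp)
      obtain ⟨l1, l2⟩ := hL.1 l (by simp)
      obtain rfl := eq_of_append_eq m1 m2 l1 l2 h
      have h' := append_left_cancel h
      rw [ih (concat L) ⟨fun x hx => hL.1 x (by simp [hx]), rfl⟩ M
        ⟨fun x hx => hM.1 x (by simp [hx]), h'.symm⟩]

/-- The components of `π`: the unique sequence `σ₁, …, σ_m` of nonempty connected partitions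
with `π = σ₁[σ₂]⋯[σ_m]`. -/
noncomputable def components (π : SetPartition) : List SetPartition :=
  (existsUnique_isDecomposition π).choose

lemma isDecomposition_components (π : SetPartition) : π.IsDecomposition π.components :=
  (existsUnique_isDecomposition π).choose_spec.1

/-- The number of components of a partition. -/
noncomputable def numComponents (π : SetPartition) : ℕ := π.components.length

/-- cc-equivalence of `σ` and `τ`: there is a bijection from the non-crossing partitions
avoiding `σ` onto the non-crossing partitions avoiding `τ` that preserves the size and the
number of components. -/
def CCEquiv (σ τ : SetPartition) : Prop :=
  ∃ f : {π : SetPartition // π.NonCrossing ∧ π.Avoids σ} ≃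
      {π : SetPartition // π.NonCrossing ∧ π.Avoids τ},
    ∀ π, (f π).1.size = π.1.size ∧ (f π).1.numComponents = π.1.numComponents

end SetPartition

end PartitionPattern

/-!
A non-crossing partition is a forest: its trees are its components, and a nonempty connected
non-crossing partition is `π` followed by a letter `1` for a unique non-crossing `π`
(`exists_eq_close`). So there is a bijection `closeEquiv` between forests and trees, under which
the size is one more for the tree, and the number of components is the length of the forest.

If `σ` is nonempty and connected, a forest contains `σ` exactly when one of its trees does
(`contains_append_iff`). A forest containing `σ` can therefore be split as `V[K][N]` where `K` is
its first tree containing `σ`; either `K` is minimal, meaning that removing its last letter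
destroys all occurrences of `σ`, or `K` comes from a smaller forest containing `σ` and is split in
turn. This ends with a minimal tree `c` and a sequence of pairs `(V₀, N₀), …, (Vᵣ, Nᵣ)`, numbered
from the inside out, where the `Vᵢ` avoid `σ` and the rest is arbitrary. Along this spine the
forest contains `σ[ρ]` if and only if `N₀[N₁]⋯[Nᵣ]` contains `ρ` (`contains_append_nest_iff`):
`σ`-avoiding partitions in front are irrelevant, closing letters are irrelevant once `σ` is
present, and an occurrence of `σ` uses the last letter of `c`.

Splitting at the last tree containing `σ` instead, as `N[K][V]`, gives the same kind of data, and
now the forest contains `ρ[σ]` if and only if `Nᵣ[⋯][N₁][N₀]` contains `ρ`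
(`contains_append_nest_reverse_iff`). So it suffices to keep `c` and the `Vᵢ`, and to cut the list
of components of `N₀[N₁]⋯[Nᵣ]` anew so that the piece for each index keeps its number of
components while the pieces are taken in the opposite order (`reverseSnd`). This preserves the
size and the number of components at every level. On partitions avoiding `σ`, which avoid both
patterns, the bijection is the identity.
-/

namespace PartitionPattern

/-! ### Occurrences of words -/

/-- `Occurs u v`: the word `u` has a subsequence order-isomorphic to `v`, the isomorphism being
given by a relabelling `g` of the letters of `v`. -/
def Occurs (u v : List ℕ) : Prop :=
  ∃ g : ℕ → ℕ, StrictMonoOn g {x | x ∈ v} ∧ (v.map g).Sublist u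

lemma Occurs.mono {u u' v : List ℕ} (h : Occurs u v) (hu : u.Sublist u') : Occurs u' v := by
  obtain ⟨g, hg, hs⟩ := h
  exact ⟨g, hg, hs.trans hu⟩

lemma occurs_map_add {k : ℕ} {u v : List ℕ} : Occurs (u.map (· + k)) v ↔ Occurs u v := by
  constructor
  · rintro ⟨g, hg, hs⟩
    obtain ⟨u', hu', h⟩ := List.sublist_map_iff.1 hs
    have hk : ∀ x ∈ v, k ≤ g x := by
      intro x hx
      have : g x ∈ u'.map (· + k) := h ▸ List.mem_map_of_mem hx
      obtain ⟨y, -, hy⟩ := List.mem_map.1 this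
      omega
    refine ⟨fun x => g x - k, fun x hx y hy hxy => ?_, ?_⟩
    · have := hg hx hy hxy
      have := hk x hx
      dsimp only
      omega
    · have : v.map (fun x => g x - k) = u' := by
        have h2 := congrArg (List.map (· - k)) h
        simpa [Function.comp_def] using h2
      rwa [this]
  · rintro ⟨g, hg, hs⟩
    refine ⟨fun x => g x + k, fun x hx y hy hxy => ?_, ?_⟩
    · have := hg hx hy hxy
      dsimp only
      omega
    · simpa [Function.comp_def] using hs.map (· + k)

lemma strictMonoOn_comp_add {k : ℕ} {g : ℕ → ℕ} {v : List ℕ}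
    (hg : StrictMonoOn g {x | x ∈ v.map (· + k)}) :
    StrictMonoOn (fun x => g (x + k)) {x | x ∈ v} := fun _ hx _ hy hxy =>
  hg (List.mem_map_of_mem (f := (· + k)) hx) (List.mem_map_of_mem (f := (· + k)) hy)
    (Nat.add_lt_add_right hxy k)

lemma occurs_of_map_add_sublist {k : ℕ} {g : ℕ → ℕ} {u v : List ℕ}
    (hg : StrictMonoOn g {x | x ∈ v.map (· + k)}) (h : ((v.map (· + k)).map g).Sublist u) :
    Occurs u v :=
  ⟨fun x => g (x + k), strictMonoOn_comp_add hg, by simpa [Function.comp_def] using h⟩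

lemma Occurs.map_add {u v : List ℕ} (h : Occurs u v) (k : ℕ) : Occurs u (v.map (· + k)) := by
  obtain ⟨g, hg, hs⟩ := h
  refine ⟨fun x => g (x - k), ?_, by simpa [Function.comp_def] using hs⟩
  intro x hx y hy hxy
  obtain ⟨x, hx', rfl⟩ := List.mem_map.1 hx
  obtain ⟨y, hy', rfl⟩ := List.mem_map.1 hy
  simpa using hg hx' hy' (Nat.lt_of_add_lt_add_right hxy)

lemma Occurs.append {u₁ u₂ v₁ v₂ : List ℕ} (h₁ : Occurs u₁ v₁) (h₂ : Occurs u₂ v₂)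
    (hu : ∀ x ∈ u₁, ∀ y ∈ u₂, x < y) (hv : ∀ x ∈ v₁, ∀ y ∈ v₂, x < y) :
    Occurs (u₁ ++ u₂) (v₁ ++ v₂) := by
  classical
  obtain ⟨g₁, hg₁, hs₁⟩ := h₁
  obtain ⟨g₂, hg₂, hs₂⟩ := h₂
  have e₁ : ∀ x ∈ v₁, (if x ∈ v₁ then g₁ x else g₂ x) = g₁ x := fun x hx => if_pos hx
  have e₂ : ∀ x ∈ v₂, (if x ∈ v₁ then g₁ x else g₂ x) = g₂ x :=
    fun x hx => if_neg fun h => (hv x h x hx).false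
  refine ⟨fun x => if x ∈ v₁ then g₁ x else g₂ x, fun x hx y hy hxy => ?_, ?_⟩
  · rcases List.mem_append.1 hx with hx | hx <;> rcases List.mem_append.1 hy with hy | hy
    · simpa only [e₁ x hx, e₁ y hy] using hg₁ hx hy hxy
    · simpa only [e₁ x hx, e₂ y hy] using
        hu _ (hs₁.subset (List.mem_map_of_mem hx)) _ (hs₂.subset (List.mem_map_of_mem hy))
    · exact absurd (hv y hy x hx) hxy.not_gt
    · simpa only [e₂ x hx, e₂ y hy] using hg₂ hx hy hxy
  · rw [List.map_append, List.map_congr_left e₁, List.map_congr_left e₂]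
    exact hs₁.append hs₂

/-- Where a subsequence `s₁ ++ s₂` of `u₁ ++ u₂` is cut by the boundary between `u₁` and `u₂`. -/
lemma append_sublist_append_cases {s₁ s₂ u₁ u₂ : List ℕ} (h : (s₁ ++ s₂).Sublist (u₁ ++ u₂)) :
    (∃ a b, s₁ = a ++ b ∧ a.Sublist u₁ ∧ (b ++ s₂).Sublist u₂) ∨
      ∃ a b, s₂ = a ++ b ∧ (s₁ ++ a).Sublist u₁ ∧ b.Sublist u₂ := by
  obtain ⟨l₁, l₂, h, h₁, h₂⟩ := List.sublist_append_iff.1 h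
  rcases List.append_eq_append_iff.1 h with ⟨a, rfl, rfl⟩ | ⟨a, rfl, rfl⟩
  · exact Or.inr ⟨a, l₂, rfl, h₁, h₂⟩
  · exact Or.inl ⟨l₁, a, rfl, h₁, h₂⟩

/-! ### Restricted growth functions -/

lemma IsRGF.mem_iff {w : List ℕ} (h : IsRGF w) {x : ℕ} : x ∈ w ↔ 1 ≤ x ∧ x ≤ maxLetter w := by
  rw [← List.mem_toFinset, h.toFinset_eq, Finset.mem_Icc]

/-- A final segment of a restricted growth function whose letters exceed all earlier letters
is a shifted restricted growth function. -/
lemma IsRGF.exists_map_add {u v : List ℕ} (h : IsRGF (u ++ v)) (hv : ∀ y ∈ v, maxLetter u < y) :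
    ∃ v', IsRGF v' ∧ v = v'.map (· + maxLetter u) := by
  induction v using List.reverseRecOn with
  | nil => exact ⟨[], isRGF_nil, rfl⟩
  | append_singleton v a ih =>
    rw [← List.append_assoc, isRGF_append_singleton] at h
    obtain ⟨v', hv', rfl⟩ := ih h.1 fun y hy => hv y (List.mem_append_left _ hy)
    rw [maxLetter_append_map] at h
    have ha := hv a (by simp)
    refine ⟨v' ++ [a - maxLetter u], (isRGF_append_singleton _ _).2 ⟨hv', by omega, by omega⟩, ?_⟩
    rw [List.map_append, List.map_singleton, Nat.sub_add_cancel ha.le]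

namespace SetPartition

lemma numBlocks_eq (π : SetPartition) : π.numBlocks = maxLetter π.word := π.rgf.card_toFinset

lemma mem_word_iff {π : SetPartition} {x : ℕ} : x ∈ π.word ↔ 1 ≤ x ∧ x ≤ π.numBlocks := by
  rw [numBlocks_eq, π.rgf.mem_iff]

lemma lt_of_mem_word {σ ρ : SetPartition} :
    ∀ x ∈ σ.word, ∀ y ∈ ρ.word.map (· + σ.numBlocks), x < y := by
  intro x hx y hy
  obtain ⟨z, hz, rfl⟩ := List.mem_map.1 hy
  have := mem_word_iff.1 hx
  have := mem_word_iff.1 hz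
  omega

lemma contains_iff_occurs {π τ : SetPartition} : π.Contains τ ↔ Occurs π.word τ.word := by
  constructor
  · rintro ⟨f, hf, h⟩
    have key : ∀ i j, τ.word.get i = τ.word.get j → π.word.get (f i) = π.word.get (f j) := by
      intro i j hij
      have h1 := (h i j).1
      have h2 := (h i j).2
      omega
    have hidx : ∀ x ∈ τ.word, ∃ i, τ.word.get i = x := fun x hx => List.mem_iff_get.1 hx
    by_cases hτ : τ.word = []
    · exact ⟨id, strictMono_id.strictMonoOn _, by simp [hτ]⟩
    have : Nonempty (Fin τ.word.length) := ⟨⟨0, List.length_pos_iff.2 hτ⟩⟩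
    choose! idx hi using hidx
    refine ⟨fun x => π.word.get (f (idx x)), fun x hx y hy hxy => ?_, ?_⟩
    · rw [← hi x hx, ← hi y hy] at hxy
      exact (h _ _).1.2 hxy
    · rw [List.sublist_iff_exists_fin_orderEmbedding_get_eq]
      have hl : (τ.word.map fun x => π.word.get (f (idx x))).length = τ.word.length := by simp
      refine ⟨OrderEmbedding.ofStrictMono (fun i => f (Fin.cast hl i)) fun i j hij => hf hij, ?_⟩
      intro i
      have := key (idx (τ.word.get (Fin.cast hl i))) (Fin.cast hl i) (hi _ (List.get_mem _ _))
      simpa using this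
  · rintro ⟨g, hg, hs⟩
    obtain ⟨f, hf⟩ := List.sublist_iff_exists_fin_orderEmbedding_get_eq.1 hs
    have hl : τ.word.length = (τ.word.map g).length := by simp
    have hf' : ∀ i, π.word.get (f (Fin.cast hl i)) = g (τ.word.get i) := by
      intro i
      rw [← hf]
      simp
    refine ⟨fun i => f (Fin.cast hl i), fun i j hij => f.strictMono hij, fun i j => ?_⟩
    simp only [hf', gt_iff_lt]
    exact ⟨hg.lt_iff_lt (List.get_mem _ _) (List.get_mem _ _),
      hg.lt_iff_lt (List.get_mem _ _) (List.get_mem _ _)⟩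

lemma Contains.of_sublist {π π' τ : SetPartition} (h : π.Contains τ)
    (hs : π.word.Sublist π'.word) : π'.Contains τ :=
  contains_iff_occurs.2 ((contains_iff_occurs.1 h).mono hs)

lemma Contains.append_right {π τ : SetPartition} (h : π.Contains τ) (π' : SetPartition) :
    (π.append π').Contains τ :=
  h.of_sublist (List.sublist_append_left _ _)

lemma Contains.append_left {π τ : SetPartition} (h : π.Contains τ) (π' : SetPartition) :
    (π'.append π).Contains τ := by
  rw [contains_iff_occurs] at h ⊢
  exact (occurs_map_add.2 h).mono (List.sublist_append_right _ _)

lemma contains_of_contains_append_left {π σ ρ : SetPartition} (h : π.Contains (σ.append ρ)) :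
    π.Contains σ := by
  rw [contains_iff_occurs] at h ⊢
  obtain ⟨g, hg, hs⟩ := h
  rw [append_word, List.map_append] at hs
  exact ⟨g, hg.mono fun x hx => List.mem_append_left _ hx, (List.sublist_append_left _ _).trans hs⟩

lemma contains_of_contains_append_right {π σ ρ : SetPartition} (h : π.Contains (σ.append ρ)) :
    π.Contains ρ := by
  rw [contains_iff_occurs] at h ⊢
  obtain ⟨g, hg, hs⟩ := h
  rw [append_word, List.map_append] at hs
  exact occurs_of_map_add_sublist (hg.mono fun x hx => List.mem_append_right _ hx)
    ((List.sublist_append_right _ _).trans hs)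

lemma Contains.append {π π' σ ρ : SetPartition} (h : π.Contains σ) (h' : π'.Contains ρ) :
    (π.append π').Contains (σ.append ρ) := by
  rw [contains_iff_occurs] at h h' ⊢
  exact h.append ((occurs_map_add.2 h').map_add _) lt_of_mem_word lt_of_mem_word

/-- A cut of the word of `τ` such that all letters before it are smaller than all letters after it
is a factorization `τ = σ[ρ]`. -/
lemma exists_eq_append {τ : SetPartition} {u v : List ℕ} (h : τ.word = u ++ v)
    (huv : ∀ x ∈ u, ∀ y ∈ v, x < y) :
    ∃ σ ρ : SetPartition, σ.word = u ∧ ρ.word.map (· + σ.numBlocks) = v ∧ τ = σ.append ρ := by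
  have hr := τ.rgf
  rw [h] at hr
  have hv : ∀ y ∈ v, maxLetter u < y := by
    intro y hy
    rcases u.eq_nil_or_concat with rfl | ⟨u', a, rfl⟩
    · have : y ∈ τ.word := by rw [h]; exact List.mem_append_right _ hy
      have := mem_word_iff.1 this
      simpa [maxLetter, Nat.lt_iff_add_one_le] using this.1
    · refine huv _ (hr.left.mem_iff.2 ⟨?_, le_rfl⟩) y hy
      have := hr.left.mem_iff.1 (show a ∈ u'.concat a by simp)
      omega
  obtain ⟨v', hv', rfl⟩ := hr.exists_map_add hv
  have hn := numBlocks_eq ⟨u, hr.left⟩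
  refine ⟨⟨u, hr.left⟩, ⟨v', hv'⟩, rfl, ?_, SetPartition.ext ?_⟩
  · rw [hn]
  · rw [append_word, hn, h]

/-- A copy of a connected pattern cannot be cut into two nonempty parts of which the first uses
smaller letters than the second. -/
lemma eq_nil_or_eq_nil_of_map_eq_append {τ : SetPartition} (hτ : τ.Connected) {g : ℕ → ℕ}
    (hg : StrictMonoOn g {x | x ∈ τ.word}) {u v : List ℕ} (h : τ.word.map g = u ++ v)
    (huv : ∀ x ∈ u, ∀ y ∈ v, x < y) : u = [] ∨ v = [] := by
  by_contra! hne
  obtain ⟨u', v', he, rfl, rfl⟩ := List.map_eq_append_iff.1 h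
  obtain ⟨σ, ρ, hσ, hρ, hap⟩ := exists_eq_append he fun x hx y hy =>
    (hg.lt_iff_lt (by simp [he, hx]) (by simp [he, hy])).1
      (huv _ (List.mem_map_of_mem hx) _ (List.mem_map_of_mem hy))
  refine hτ ⟨σ, ρ, ?_, ?_, hap⟩
  · rw [ne_empty_iff, hσ]
    rintro rfl
    exact hne.1 rfl
  · rw [ne_empty_iff]
    intro h0
    rw [h0] at hρ
    exact hne.2 (by rw [← hρ]; rfl)

/-- An occurrence of a connected pattern does not straddle the two parts of `σ[ρ]`. -/
lemma contains_append_iff {σ ρ τ : SetPartition} (hτ : τ.Connected) :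
    (σ.append ρ).Contains τ ↔ σ.Contains τ ∨ ρ.Contains τ := by
  refine ⟨fun h => ?_, fun h => h.elim (·.append_right ρ) (·.append_left σ)⟩
  simp only [contains_iff_occurs] at h ⊢
  obtain ⟨g, hg, hs⟩ := h
  obtain ⟨l₁, l₂, he, h₁, h₂⟩ := List.sublist_append_iff.1 hs
  rcases eq_nil_or_eq_nil_of_map_eq_append hτ hg he
    fun x hx y hy => lt_of_mem_word x (h₁.subset hx) y (h₂.subset hy) with rfl | rfl
  · exact Or.inr (occurs_map_add.1 ⟨g, hg, by rwa [he]⟩)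
  · exact Or.inl ⟨g, hg, by rwa [he, List.append_nil]⟩

/-- Prepending a `σ`-avoiding partition creates no occurrence of `σ[ρ]`. -/
lemma contains_append_append_iff_of_avoids_left {σ ρ π π' : SetPartition} (hσ : σ.Connected)
    (h : ¬ π.Contains σ) :
    (π.append π').Contains (σ.append ρ) ↔ π'.Contains (σ.append ρ) := by
  refine ⟨fun hc => ?_, fun h => h.append_left π⟩
  simp only [contains_iff_occurs] at h hc ⊢
  obtain ⟨g, hg, hs⟩ := hc
  have hgσ : StrictMonoOn g {x | x ∈ σ.word} := hg.mono fun x hx => List.mem_append_left _ hx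
  have hs' := hs
  rw [append_word, append_word, List.map_append] at hs'
  rcases append_sublist_append_cases hs' with ⟨a, b, hab, ha, hb⟩ | ⟨a, b, -, ha, -⟩
  · rcases eq_nil_or_eq_nil_of_map_eq_append hσ hgσ hab fun x hx y hy =>
      lt_of_mem_word x (ha.subset hx) y (hb.subset (List.mem_append_left _ hy)) with rfl | rfl
    · refine (occurs_map_add (k := π.numBlocks)).1 ⟨g, hg, ?_⟩
      rw [append_word, List.map_append, hab]
      exact hb
    · exact absurd ⟨g, hgσ, by rw [hab]; simpa using ha⟩ h
  · exact absurd ⟨g, hgσ, (List.sublist_append_left _ _).trans ha⟩ h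

/-- Appending a `σ`-avoiding partition creates no occurrence of `ρ[σ]`. -/
lemma contains_append_append_iff_of_avoids_right {σ ρ π π' : SetPartition} (hσ : σ.Connected)
    (h : ¬ π'.Contains σ) :
    (π.append π').Contains (ρ.append σ) ↔ π.Contains (ρ.append σ) := by
  refine ⟨fun hc => ?_, fun h => h.append_right π'⟩
  simp only [contains_iff_occurs] at h hc ⊢
  obtain ⟨g, hg, hs⟩ := hc
  have hgσ : StrictMonoOn g {x | x ∈ σ.word.map (· + ρ.numBlocks)} :=
    hg.mono fun x hx => List.mem_append_right _ hx
  have hs' := hs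
  rw [append_word, append_word, List.map_append] at hs'
  rcases append_sublist_append_cases hs' with ⟨a, b, -, -, hb⟩ | ⟨a, b, hab, ha, hb⟩
  · exact absurd (occurs_map_add.1 (occurs_of_map_add_sublist hgσ
      ((List.sublist_append_right _ _).trans hb))) h
  · rcases eq_nil_or_eq_nil_of_map_eq_append hσ (strictMonoOn_comp_add hgσ)
      (by rw [← hab, List.map_map]; rfl) fun x hx y hy =>
      lt_of_mem_word x (ha.subset (List.mem_append_right _ hx)) y (hb.subset hy) with rfl | rfl
    · exact absurd (occurs_map_add.1
        (occurs_of_map_add_sublist hgσ (by rw [hab]; simpa using hb))) h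
    · refine ⟨g, hg, ?_⟩
      rw [append_word, List.map_append, hab]
      simpa using ha

/-! ### Closing a partition with a final `1` -/

/-- The partition obtained from `π` by adding a new last element to the first block (to a new
block, if `π` is empty). -/
def close (π : SetPartition) : SetPartition :=
  ⟨π.word ++ [1], (isRGF_append_singleton _ _).2 ⟨π.rgf, le_rfl, by omega⟩⟩

lemma close_word (π : SetPartition) : π.close.word = π.word ++ [1] := rfl

lemma close_injective : Function.Injective close := fun _ _ h =>
  SetPartition.ext (List.append_cancel_right (congrArg word h))

lemma size_close (π : SetPartition) : π.close.size = π.size + 1 := by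
  simp [size, close_word]

lemma close_ne_empty (π : SetPartition) : π.close ≠ empty := by
  simp [ne_empty_iff, close_word]

lemma numBlocks_close {π : SetPartition} (h : π ≠ empty) : π.close.numBlocks = π.numBlocks := by
  obtain ⟨x, hx⟩ := List.exists_mem_of_ne_nil _ (ne_empty_iff.1 h)
  have := mem_word_iff.1 hx
  rw [numBlocks_eq] at this
  rw [numBlocks_eq, numBlocks_eq, close_word, maxLetter_append]
  simp only [maxLetter, List.foldr_cons, List.foldr_nil] at this ⊢
  omega

lemma connected_close (π : SetPartition) : π.close.Connected := by
  rintro ⟨σ, τ, hσ, hτ, h⟩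
  obtain ⟨x, hx⟩ := List.exists_mem_of_ne_nil _ (ne_empty_iff.1 hσ)
  rcases τ.word.eq_nil_or_concat with h0 | ⟨t, a, hta⟩
  · exact ne_empty_iff.1 hτ h0
  have ha : a ∈ τ.word := by simp [hta]
  have hlt := lt_of_mem_word (ρ := τ) x hx _ (List.mem_map_of_mem ha)
  have h' := congrArg word h
  rw [close_word, append_word, hta, List.concat_eq_append, List.map_append, List.map_singleton,
    ← List.append_assoc] at h'
  have := List.append_inj_right' h' rfl
  have := (mem_word_iff.1 hx).1
  simp only [List.cons.injEq, and_true] at *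
  omega

lemma Contains.close {π τ : SetPartition} (h : π.Contains τ) : π.close.Contains τ :=
  h.of_sublist (List.sublist_append_left _ _)

/-- The new last letter of `π.close` cannot serve in the part `ρ` of an occurrence of `σ[ρ]`
in `π.close[ν]`; if it serves in the part `σ`, then `ρ` occurs in `ν`. -/
lemma contains_of_contains_close_append {π ν σ ρ : SetPartition} (hσ : σ ≠ empty)
    (h : (π.close.append ν).Contains (σ.append ρ)) :
    ν.Contains ρ ∨ (π.append ν).Contains (σ.append ρ) := by
  simp only [contains_iff_occurs] at h ⊢
  obtain ⟨g, hg, hs⟩ := h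
  have hgρ : StrictMonoOn g {x | x ∈ ρ.word.map (· + σ.numBlocks)} :=
    hg.mono fun x hx => List.mem_append_right _ hx
  obtain ⟨x, hx⟩ := List.exists_mem_of_ne_nil _ (ne_empty_iff.1 hσ)
  have hone : 1 ∉ (ρ.word.map (· + σ.numBlocks)).map g := by
    intro h1
    obtain ⟨y, hy, hy1⟩ := List.mem_map.1 h1
    have h2 := hg (List.mem_append_left _ hx) (List.mem_append_right _ hy)
      (lt_of_mem_word x hx y hy)
    have h3 : g x ∈ (π.close.append ν).word :=
      hs.subset (List.mem_map_of_mem (List.mem_append_left _ hx))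
    have := (mem_word_iff.1 h3).1
    omega
  have hskip : ∀ {s t : List ℕ}, 1 ∉ s → s.Sublist (1 :: t) → s.Sublist t := by
    intro s t h1 h
    rcases List.sublist_cons_iff.1 h with h | ⟨r, rfl, -⟩
    · exact h
    · simp at h1
  have hs' := hs
  rw [append_word, append_word, List.map_append, close_word, List.append_assoc,
    List.singleton_append] at hs'
  rcases append_sublist_append_cases hs' with ⟨a, b, -, -, hb⟩ | ⟨a, b, hab, ha, hb⟩
  · have := hskip hone ((List.sublist_append_right _ _).trans hb)
    exact Or.inl (occurs_map_add.1 (occurs_of_map_add_sublist hgρ this))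
  · have hπ : π ≠ empty := by
      rw [ne_empty_iff]
      intro h0
      rw [h0, List.sublist_nil, List.append_eq_nil_iff, List.map_eq_nil_iff] at ha
      exact ne_empty_iff.1 hσ ha.1
    have hb' := hskip (fun h1 => hone (hab ▸ List.mem_append_right _ h1)) hb
    refine Or.inr ⟨g, hg, ?_⟩
    rw [append_word, append_word, List.map_append, hab, ← List.append_assoc,
      ← numBlocks_close hπ]
    exact ha.append hb'

/-- The mirror image of `contains_of_contains_close_append`: if the new last letter of `π.close`
serves in an occurrence of `ρ[σ]` in `ν[π.close]`, it does so in the part `σ`; being the least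
letter of `π.close`, it exceeds all letters used by `ρ`, which therefore lie in `ν`. -/
lemma contains_of_contains_append_close {π ν σ ρ : SetPartition} (hσ : σ ≠ empty)
    (h : (ν.append π.close).Contains (ρ.append σ)) :
    ν.Contains ρ ∨ (ν.append π).Contains (ρ.append σ) := by
  simp only [contains_iff_occurs] at h ⊢
  obtain ⟨g, hg, hs⟩ := h
  have hlt : ∀ x ∈ ρ.word.map g, ∀ y ∈ (σ.word.map (· + ρ.numBlocks)).map g, x < y := by
    intro x hx y hy
    obtain ⟨x, hx', rfl⟩ := List.mem_map.1 hx
    obtain ⟨y, hy', rfl⟩ := List.mem_map.1 hy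
    exact hg (List.mem_append_left _ hx') (List.mem_append_right _ hy') (lt_of_mem_word x hx' y hy')
  have key : 1 + ν.numBlocks ∈ (σ.word.map (· + ρ.numBlocks)).map g →
      (ρ.word.map g).Sublist (ν.word ++ π.word.map (· + ν.numBlocks)) → Occurs ν.word ρ.word := by
    intro hm hsub
    refine ⟨g, hg.mono fun x hx => List.mem_append_left _ hx, ?_⟩
    obtain ⟨a, b, hab, ha, hb⟩ := List.sublist_append_iff.1 hsub
    rcases b with _ | ⟨y, b⟩
    · rw [hab, List.append_nil]
      exact ha
    · have h1 := hlt y (by simp [hab]) _ hm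
      obtain ⟨z, hz, hzy⟩ := List.mem_map.1 (hb.subset (List.mem_cons_self ..))
      have := (mem_word_iff.1 hz).1
      omega
  have hs' := hs
  rw [append_word, append_word, List.map_append, close_word, List.map_append, List.map_singleton,
    ← List.append_assoc] at hs'
  rcases append_sublist_append_cases hs' with ⟨a, b, hab, ha, hb⟩ | ⟨a, b, hab, ha, hb⟩
  · have hl := hb.length_le
    have hσl := List.length_pos_iff.2 (ne_empty_iff.1 hσ)
    simp only [List.length_append, List.length_map, List.length_singleton] at hl
    obtain rfl : b = [] := List.length_eq_zero_iff.1 (by omega)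
    rw [List.nil_append] at hb
    have := hb.eq_of_length (by simp; omega)
    exact Or.inl (key (by rw [this]; simp) (by rw [hab, List.append_nil]; exact ha))
  · rcases List.sublist_singleton.1 hb with rfl | rfl
    · refine Or.inr ⟨g, hg, ?_⟩
      rw [append_word, append_word, List.map_append, hab, List.append_nil]
      exact ha
    · exact Or.inl (key (by rw [hab]; simp) ((List.sublist_append_left _ _).trans ha))

lemma contains_close_append_iff {π ν σ ρ : SetPartition} (hσ : σ ≠ empty) (h : π.Contains σ) :
    (π.close.append ν).Contains (σ.append ρ) ↔ (π.append ν).Contains (σ.append ρ) := by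
  refine ⟨fun hc => (contains_of_contains_close_append hσ hc).elim h.append id,
    fun hc => hc.of_sublist ?_⟩
  have hπ : π ≠ empty := by
    rintro rfl
    obtain ⟨f, -⟩ := h
    exact (f ⟨0, List.length_pos_iff.2 (ne_empty_iff.1 hσ)⟩).elim0
  rw [append_word, append_word, numBlocks_close hπ]
  exact (List.sublist_append_left _ _).append (List.Sublist.refl _)

lemma contains_append_close_iff {π ν σ ρ : SetPartition} (hσ : σ ≠ empty) (h : π.Contains σ) :
    (ν.append π.close).Contains (ρ.append σ) ↔ (ν.append π).Contains (ρ.append σ) := by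
  refine ⟨fun hc => (contains_of_contains_append_close hσ hc).elim (·.append h) id,
    fun hc => hc.of_sublist ?_⟩
  rw [append_word, append_word]
  exact (List.Sublist.refl _).append ((List.sublist_append_left _ _).map _)

/-! ### Non-crossing partitions as forests -/

lemma connected_p1212 : p1212.Connected := by
  rintro ⟨σ, τ, hσ, hτ, h⟩
  have hlt := lt_of_mem_word (σ := σ) (ρ := τ)
  have h' : [1, 2, 1, 2] = σ.word ++ τ.word.map (· + σ.numBlocks) := congrArg word h
  have hτ' : τ.word.map (· + σ.numBlocks) ≠ [] := by
    simpa using ne_empty_iff.1 hτ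
  have hσ' := ne_empty_iff.1 hσ
  generalize σ.word = u at *
  generalize τ.word.map (· + σ.numBlocks) = v at *
  rcases u with _ | ⟨a, _ | ⟨b, _ | ⟨c, _ | ⟨d, u⟩⟩⟩⟩ <;>
    simp only [List.nil_append, List.cons_append, List.cons.injEq, List.nil_eq,
      List.append_eq_nil_iff] at h'
  · exact hσ' rfl
  · obtain ⟨rfl, rfl⟩ := h'
    exact absurd (hlt 1 (by simp) 1 (by simp)) (by omega)
  · obtain ⟨rfl, rfl, rfl⟩ := h'
    exact absurd (hlt 1 (by simp) 1 (by simp)) (by omega)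
  · obtain ⟨rfl, rfl, rfl, rfl⟩ := h'
    exact absurd (hlt 2 (by simp) 2 (by simp)) (by omega)
  · exact hτ' h'.2.2.2.2.2

lemma nonCrossing_append_iff {σ ρ : SetPartition} :
    (σ.append ρ).NonCrossing ↔ σ.NonCrossing ∧ ρ.NonCrossing := by
  simp only [NonCrossing, Avoids, contains_append_iff connected_p1212, not_or]

lemma nonCrossing_close_iff {π : SetPartition} : π.close.NonCrossing ↔ π.NonCrossing := by
  refine ⟨fun h hc => h hc.close, fun h hc => h ?_⟩
  rw [contains_iff_occurs] at hc ⊢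
  obtain ⟨g, hg, hs⟩ := hc
  refine ⟨g, hg, ?_⟩
  have h12 : g 1 < g 2 := hg (by simp [p1212]) (by simp [p1212]) one_lt_two
  have h1 : 1 ≤ g 1 := (mem_word_iff.1 (hs.subset
    (List.mem_map_of_mem (show 1 ∈ p1212.word by simp [p1212])))).1
  have hs' : ([g 1, g 2, g 1] ++ [g 2]).Sublist (π.word ++ [1]) := hs
  rcases append_sublist_append_cases hs' with ⟨a, b, -, -, hb⟩ | ⟨a, b, hab, ha, hb⟩
  · have := hb.subset (List.mem_append_right b (List.mem_singleton_self (g 2)))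
    simp at this
    omega
  · rcases List.sublist_singleton.1 hb with rfl | rfl
    · rw [List.append_nil] at hab
      rw [← hab] at ha
      exact ha
    · have := congrArg (fun l => (1 : ℕ) ∈ l) hab
      simp at this
      omega

/-- A nonempty connected non-crossing partition has its last element in the first block. -/
lemma exists_eq_close {κ : SetPartition} (h0 : κ ≠ empty) (hc : κ.Connected)
    (hn : κ.NonCrossing) : ∃ π : SetPartition, π.NonCrossing ∧ κ = π.close := by
  obtain ⟨x, hx⟩ := List.exists_mem_of_ne_nil _ (ne_empty_iff.1 h0)
  have h1 : 1 ∈ κ.word := by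
    have := mem_word_iff.1 hx
    exact mem_word_iff.2 ⟨le_rfl, this.1.trans this.2⟩
  -- cut the word after its last `1`
  obtain ⟨v', u', h', hv'⟩ := List.eq_append_cons_of_mem (List.mem_reverse.2 h1)
  obtain ⟨u, v, hκ, hv⟩ : ∃ u v, κ.word = (u ++ [1]) ++ v ∧ 1 ∉ v :=
    ⟨u'.reverse, v'.reverse, by simpa using congrArg List.reverse h', by simpa using hv'⟩
  have hr := κ.rgf
  rw [hκ] at hr
  have huv : ∀ x ∈ u ++ [1], ∀ y ∈ v, x < y := by
    intro x hx y hy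
    by_contra! hyx
    have hyκ : y ∈ κ.word := by rw [hκ]; exact List.mem_append_right _ hy
    have hy1 : y ≠ 1 := fun h => hv (h ▸ hy)
    have hy2 : 1 < y := by
      have := (mem_word_iff.1 hyκ).1
      omega
    have hyu : y ∈ u := by
      have := hr.left.mem_iff.2 ⟨hy2.le, hyx.trans (hr.left.mem_iff.1 hx).2⟩
      simpa [hy1] using this
    -- a letter `y` of both `u` and `v` crosses the first block
    apply hn
    rw [contains_iff_occurs]
    obtain ⟨u', rfl⟩ : ∃ u', u = 1 :: u' := by
      cases u with
      | nil => simp at hyu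
      | cons a u' =>
        have := hr 0 (by simp)
        simp only [List.cons_append, List.getElem_cons_zero, List.take_zero, maxLetter,
          List.foldr_nil] at this
        exact ⟨u', by rw [show a = 1 by omega]⟩
    have hyu' : y ∈ u' := by simpa [hy1] using hyu
    refine ⟨fun x => if x = 1 then 1 else y, ?_, ?_⟩
    · intro a ha b hb hab
      simp only [p1212, List.mem_cons, List.not_mem_nil, or_false, Set.mem_ofPred_eq] at ha hb
      dsimp only
      rw [if_pos (by omega), if_neg (by omega)]
      exact hy2
    · rw [hκ]
      change ((([1] ++ [y]) ++ [1]) ++ [y]).Sublist ((([1] ++ u') ++ [1]) ++ v)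
      exact ((((List.Sublist.refl _).append (List.singleton_sublist.2 hyu')).append
        (List.Sublist.refl _)).append (List.singleton_sublist.2 hy))
  obtain ⟨σ, ρ, hσ, hρ, hap⟩ := exists_eq_append hκ huv
  have hρ0 : ρ = empty := by
    by_contra hρ0
    exact hc ⟨σ, ρ, by simp [ne_empty_iff, hσ], hρ0, hap⟩
  rw [hρ0, append_empty] at hap
  have hcl : κ = (⟨u, hr.left.left⟩ : SetPartition).close :=
    SetPartition.ext (by rw [hap, hσ]; rfl)
  exact ⟨_, nonCrossing_close_iff.1 (hcl ▸ hn), hcl⟩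

end SetPartition

/-! ### Two ways to grow a tree along a spine -/

section Spine

variable {T : Type*} (cl : List T ≃ T) (p : T → Prop)

/-- Starting from the tree `c`, repeatedly place the current tree between two forests and join
the resulting forest to a new tree; the outermost pair of forests comes first in the list. The
second forest of each pair is stored in reverse, so that replacing `cl` by `cl ∘ List.reverse`
mirrors the construction. -/
def nest (c : T) : List (List T × List T) → T
  | [] => c
  | (V, N) :: l => cl (V ++ nest c l :: N.reverse)

/-- `IsSpine cl p (c, l)`: the tree `c` satisfies `p` but none of its subtrees at the root does, and
the first forests in `l` contain no tree satisfying `p`. -/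
def IsSpine (x : T × List (List T × List T)) : Prop :=
  p x.1 ∧ (∀ κ ∈ cl.symm x.1, ¬ p κ) ∧ ∀ y ∈ x.2, ∀ κ ∈ y.1, ¬ p κ

variable {cl p}

lemma isSpine_reverse {x : T × List (List T × List T)} :
    IsSpine (List.reverse_involutive.toPerm.trans cl) p x ↔ IsSpine cl p x := by
  simp [IsSpine]

lemma IsSpine.tail {c : T} {y : List T × List T} {l : List (List T × List T)}
    (h : IsSpine cl p (c, y :: l)) : IsSpine cl p (c, l) :=
  ⟨h.1, h.2.1, fun z hz => h.2.2 z (List.mem_cons_of_mem _ hz)⟩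

lemma IsSpine.head {c : T} {V N : List T} {l : List (List T × List T)}
    (h : IsSpine cl p (c, (V, N) :: l)) : ∀ κ ∈ V, ¬ p κ := h.2.2 _ (List.mem_cons_self ..)

lemma IsSpine.nest_mem (hp : ∀ X, ∀ κ ∈ X, p κ → p (cl X)) {c : T} {l : List (List T × List T)}
    (h : IsSpine cl p (c, l)) : p (nest cl c l) := by
  induction l with
  | nil => exact h.1
  | cons y l ih => exact hp _ _ (by simp) (ih h.tail)

lemma eq_of_append_cons_eq {V V' N N' : List T} {K K' : T} (hV : ∀ κ ∈ V, ¬ p κ)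
    (hV' : ∀ κ ∈ V', ¬ p κ) (hK : p K) (hK' : p K') (h : V ++ K :: N = V' ++ K' :: N') :
    V = V' ∧ K = K' ∧ N = N' := by
  induction V generalizing V' with
  | nil =>
    cases V' with
    | nil => simpa using h
    | cons a V' =>
      rw [List.nil_append, List.cons_append, List.cons.injEq] at h
      exact absurd (h.1 ▸ hK) (hV' a (by simp))
  | cons b V ih =>
    cases V' with
    | nil =>
      rw [List.nil_append, List.cons_append, List.cons.injEq] at h
      exact absurd (h.1 ▸ hK') (hV b (by simp))
    | cons a V' =>
      rw [List.cons_append, List.cons_append, List.cons.injEq] at h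
      obtain ⟨h1, h2, h3⟩ := ih (fun κ hκ => hV κ (by simp [hκ]))
        (fun κ hκ => hV' κ (by simp [hκ])) h.2
      exact ⟨by rw [h.1, h1], h2, h3⟩

lemma exists_append_cons_of_mem {L : List T} (h : ∃ κ ∈ L, p κ) :
    ∃ V K N, L = V ++ K :: N ∧ (∀ κ ∈ V, ¬ p κ) ∧ p K := by
  induction L with
  | nil => simp at h
  | cons a L ih =>
    by_cases ha : p a
    · exact ⟨[], a, L, rfl, by simp, ha⟩
    · obtain ⟨V, K, N, rfl, hV, hK⟩ := ih (by simpa [ha] using h)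
      exact ⟨a :: V, K, N, rfl, by simpa [ha] using hV, hK⟩

lemma nest_injective (hp : ∀ X, ∀ κ ∈ X, p κ → p (cl X)) {x y : T × List (List T × List T)}
    (hx : IsSpine cl p x) (hy : IsSpine cl p y) (h : nest cl x.1 x.2 = nest cl y.1 y.2) :
    x = y := by
  obtain ⟨c, l⟩ := x
  obtain ⟨d, m⟩ := y
  induction l generalizing m with
  | nil =>
    cases m with
    | nil => exact Prod.ext h rfl
    | cons z m =>
      have hc : c = cl _ := h
      refine absurd (hy.tail.nest_mem hp) (hx.2.1 _ ?_)
      simp [hc]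
  | cons w l ih =>
    cases m with
    | nil =>
      have hd : d = cl _ := h.symm
      refine absurd (hx.tail.nest_mem hp) (hy.2.1 _ ?_)
      simp [hd]
    | cons z m =>
      obtain ⟨h1, h2, h3⟩ := eq_of_append_cons_eq hx.head hy.head (hx.tail.nest_mem hp)
        (hy.tail.nest_mem hp) (cl.injective h)
      have := ih hx.tail m hy.tail h2
      rw [Prod.mk.injEq] at this
      rw [this.1, this.2, Prod.ext h1 (List.reverse_injective h3)]

lemma exists_nest_eq {sz : T → ℕ} (hsz : ∀ X, ∀ κ ∈ X, sz κ < sz (cl X)) (κ : T) (hκ : p κ) :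
    ∃ x, IsSpine cl p x ∧ nest cl x.1 x.2 = κ := by
  induction hn : sz κ using Nat.strong_induction_on generalizing κ with
  | _ n ih =>
    by_cases h : ∃ κ' ∈ cl.symm κ, p κ'
    · obtain ⟨V, K, N, hL, hV, hK⟩ := exists_append_cons_of_mem h
      have hlt := hsz (cl.symm κ) K (by simp [hL])
      rw [Equiv.apply_symm_apply, hn] at hlt
      obtain ⟨⟨c, l⟩, hx, rfl⟩ := ih _ hlt K hK rfl
      refine ⟨(c, (V, N.reverse) :: l), ⟨hx.1, hx.2.1, ?_⟩, ?_⟩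
      · intro y hy
        rcases List.mem_cons.1 hy with rfl | hy
        · exact hV
        · exact hx.2.2 y hy
      · simp [nest, ← hL]
    · exact ⟨(κ, []), ⟨hκ, fun κ' h1 h2 => h ⟨κ', h1, h2⟩, by simp⟩, rfl⟩

variable (cl p) in
/-- Every tree satisfying `p` grows along a unique spine. -/
noncomputable def nestEquiv (hp : ∀ X, ∀ κ ∈ X, p κ → p (cl X)) (sz : T → ℕ)
    (hsz : ∀ X, ∀ κ ∈ X, sz κ < sz (cl X)) : {x // IsSpine cl p x} ≃ {κ // p κ} :=
  Equiv.ofBijective (fun x => ⟨nest cl x.1.1 x.1.2, x.2.nest_mem hp⟩)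
    ⟨fun x y h => Subtype.ext (nest_injective hp x.2 y.2 (congrArg Subtype.val h)),
      fun κ => by
        obtain ⟨x, hx, h⟩ := exists_nest_eq hsz κ.1 κ.2
        exact ⟨⟨x, hx⟩, Subtype.ext h⟩⟩

lemma size_lt_of_mem {sz : T → ℕ} (hsz : ∀ X, sz (cl X) = (X.map sz).sum + 1) {X : List T}
    {κ : T} (hκ : κ ∈ X) : sz κ < sz (cl X) := by
  rw [hsz]
  exact Nat.lt_succ_of_le (List.single_le_sum (by simp) _ (List.mem_map_of_mem hκ))

lemma size_nest {sz : T → ℕ} (hsz : ∀ X, sz (cl X) = (X.map sz).sum + 1) (c : T)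
    (l : List (List T × List T)) :
    sz (nest cl c l) = sz c + l.length + ((l.map Prod.fst).flatten.map sz).sum +
      ((l.map Prod.snd).flatten.map sz).sum := by
  induction l with
  | nil => simp [nest]
  | cons y l ih =>
    simp only [nest, hsz, List.map_append, List.sum_append, List.map_cons, List.sum_cons, ih,
      List.length_cons, List.flatten_cons, List.map_reverse, List.sum_reverse]
    omega

/-- Replace the second forests of `l` by consecutive segments of `M` of the same lengths. If `M` is
longer or shorter than the second forests together, the excess is dropped or the last segments are
cut short. -/
def refill : List (List T × List T) → List T → List (List T × List T)
  | [], _ => []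
  | (V, N) :: l, M => (V, M.take N.length) :: refill l (M.drop N.length)

lemma map_fst_refill (l : List (List T × List T)) (M : List T) :
    (refill l M).map Prod.fst = l.map Prod.fst := by
  induction l generalizing M with
  | nil => rfl
  | cons y l ih => simp [refill, ih]

lemma flatten_map_snd_refill (l : List (List T × List T)) (M : List T)
    (h : M.length = (l.map Prod.snd).flatten.length) :
    ((refill l M).map Prod.snd).flatten = M := by
  induction l generalizing M with
  | nil => simpa [refill, eq_comm] using h
  | cons y l ih =>
    rw [List.map_cons, List.flatten_cons, List.length_append] at h
    simp only [refill, List.map_cons, List.flatten_cons]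
    rw [ih _ (by rw [List.length_drop]; omega), List.take_append_drop]

lemma refill_refill (l : List (List T × List T)) (M : List T)
    (h : M.length = (l.map Prod.snd).flatten.length) :
    refill (refill l M) (l.map Prod.snd).flatten = l := by
  induction l generalizing M with
  | nil => rfl
  | cons y l ih =>
    rw [List.map_cons, List.flatten_cons, List.length_append] at h
    have h1 : (M.take y.2.length).length = y.2.length := by rw [List.length_take]; omega
    simp only [refill, List.map_cons, List.flatten_cons, h1, List.take_left', List.drop_left']
    rw [ih _ (by rw [List.length_drop]; omega)]

/-- Reverse the concatenation of the second forests of `l`, keeping their lengths. -/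
def reverseSnd (l : List (List T × List T)) : List (List T × List T) :=
  refill l (l.map Prod.snd).flatten.reverse

lemma map_fst_reverseSnd (l : List (List T × List T)) :
    (reverseSnd l).map Prod.fst = l.map Prod.fst := map_fst_refill _ _

lemma flatten_map_snd_reverseSnd (l : List (List T × List T)) :
    ((reverseSnd l).map Prod.snd).flatten = (l.map Prod.snd).flatten.reverse :=
  flatten_map_snd_refill _ _ (by rw [List.length_reverse])

lemma reverseSnd_involutive : Function.Involutive (reverseSnd (T := T)) := by
  intro l
  rw [reverseSnd, flatten_map_snd_reverseSnd, List.reverse_reverse, reverseSnd,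
    refill_refill _ _ (by rw [List.length_reverse])]

lemma IsSpine.reverseSnd {x : T × List (List T × List T)} (h : IsSpine cl p x) :
    IsSpine cl p (x.1, reverseSnd x.2) := by
  refine ⟨h.1, h.2.1, fun y hy => ?_⟩
  have := List.mem_map_of_mem (f := Prod.fst) hy
  rw [map_fst_reverseSnd] at this
  obtain ⟨z, hz, hzy⟩ := List.mem_map.1 this
  rw [← hzy]
  exact h.2.2 z hz

lemma size_nest_reverseSnd {sz : T → ℕ} (hsz : ∀ X, sz (cl X) = (X.map sz).sum + 1) (c : T)
    (l : List (List T × List T)) :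
    sz (nest (List.reverse_involutive.toPerm.trans cl) c (reverseSnd l)) = sz (nest cl c l) := by
  have hl : (reverseSnd l).length = l.length := by
    simpa using congrArg List.length (map_fst_reverseSnd l)
  rw [size_nest hsz, size_nest (sz := sz) (by simp [hsz, List.sum_reverse]), map_fst_reverseSnd,
    flatten_map_snd_reverseSnd, List.map_reverse, List.sum_reverse, hl]

/-- The permutation of forests that reads off the spine by splitting every forest at its first
tree satisfying `p`, reverses the concatenation of the second forests, and regrows a forest along
the mirrored spine, so that forests split at their last tree satisfying `p`. It fixes the forests
without a tree satisfying `p`. -/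
theorem exists_perm_forest (hp : ∀ X, ∀ κ ∈ X, p κ → p (cl X)) {sz : T → ℕ}
    (hsz : ∀ X, sz (cl X) = (X.map sz).sum + 1) :
    ∃ e : Equiv.Perm (List T), (∀ L, (∀ κ ∈ L, ¬ p κ) → e L = L) ∧
      ∀ c V N l, IsSpine cl p (c, (V, N) :: l) → ∃ N' l', IsSpine cl p (c, (V, N') :: l') ∧
        ((e (V ++ nest cl c l :: N.reverse)).map sz).sum =
          ((V ++ nest cl c l :: N.reverse).map sz).sum ∧
        N'.length = N.length ∧
        N' ++ (l'.map Prod.snd).flatten = (N ++ (l.map Prod.snd).flatten).reverse ∧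
        e (V ++ nest cl c l :: N.reverse) =
          N' ++ nest (List.reverse_involutive.toPerm.trans cl) c l' :: V.reverse := by
  classical
  -- the permutation is constructed on trees and carried over to forests by `cl`
  set cl' := (List.reverse_involutive (α := T)).toPerm.trans cl with hcl'
  have hlt : ∀ X, ∀ κ ∈ X, sz κ < sz (cl X) := fun X κ hκ => size_lt_of_mem hsz hκ
  have hp' : ∀ X, ∀ κ ∈ X, p κ → p (cl' X) := fun X κ hκ h =>
    hp _ κ (List.mem_reverse.2 hκ) h
  have hlt' : ∀ X, ∀ κ ∈ X, sz κ < sz (cl' X) := fun X κ hκ =>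
    hlt _ κ (List.mem_reverse.2 hκ)
  let r : {x // IsSpine cl p x} ≃ {x // IsSpine cl p x} :=
    Function.Involutive.toPerm (fun x => ⟨(x.1.1, reverseSnd x.1.2), x.2.reverseSnd⟩) fun x =>
      Subtype.ext (Prod.ext rfl (reverseSnd_involutive _))
  let e₀ : Equiv.Perm {κ // p κ} := ((nestEquiv cl p hp sz hlt).symm.trans r).trans
    ((Equiv.subtypeEquivRight fun x => isSpine_reverse.symm).trans (nestEquiv cl' p hp' sz hlt'))
  have he₀ : ∀ x : {x // IsSpine cl p x}, ∀ h, (e₀ ⟨nest cl x.1.1 x.1.2, h⟩ : T) =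
      nest cl' x.1.1 (reverseSnd x.1.2) := by
    intro x h
    have : (nestEquiv cl p hp sz hlt).symm ⟨nest cl x.1.1 x.1.2, h⟩ = x :=
      (Equiv.symm_apply_eq _).2 rfl
    simp only [e₀, Equiv.trans_apply, this]
    rfl
  let E : Equiv.Perm T := Equiv.Perm.ofSubtype e₀
  have hE : ∀ x, IsSpine cl p x → E (nest cl x.1 x.2) = nest cl' x.1 (reverseSnd x.2) := by
    intro x hx
    rw [← he₀ ⟨x, hx⟩ (hx.nest_mem hp)]
    exact Equiv.Perm.ofSubtype_apply_of_mem e₀ (hx.nest_mem hp)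
  refine ⟨(cl.trans E).trans cl.symm, fun L hL => ?_, fun c V N l hx => ?_⟩
  · rw [Equiv.trans_apply, Equiv.trans_apply, Equiv.symm_apply_eq]
    by_cases h : p (cl L)
    · exact hE (cl L, []) ⟨h, by simpa using hL, by simp⟩
    · exact Equiv.Perm.ofSubtype_apply_of_not_mem e₀ h
  · set M := (N ++ (l.map Prod.snd).flatten).reverse with hM
    have hr : reverseSnd ((V, N) :: l) =
      (V, M.take N.length) :: refill l (M.drop N.length) := rfl
    have hval : ((cl.trans E).trans cl.symm) (V ++ nest cl c l :: N.reverse) =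
        M.take N.length ++ nest cl' c (refill l (M.drop N.length)) :: V.reverse := by
      rw [Equiv.trans_apply, Equiv.trans_apply, Equiv.symm_apply_eq]
      have := hE _ hx
      rw [hr] at this
      refine this.trans ?_
      simp [nest, hcl']
    refine ⟨M.take N.length, refill l (M.drop N.length), hr ▸ hx.reverseSnd, ?_, ?_, ?_, hval⟩
    · have h1 := size_nest_reverseSnd hsz c ((V, N) :: l)
      rw [← hE _ hx] at h1
      have h2 : sz (cl (((cl.trans E).trans cl.symm) (V ++ nest cl c l :: N.reverse))) =
          sz (cl (V ++ nest cl c l :: N.reverse)) := by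
        simpa [nest] using h1
      rw [hsz, hsz] at h2
      omega
    · rw [List.length_take, hM, List.length_reverse, List.length_append]
      omega
    · have := flatten_map_snd_reverseSnd ((V, N) :: l)
      rw [hr] at this
      simpa [hM] using this

end Spine

namespace SetPartition

/-! ### The map on non-crossing partitions -/

/-- The nonempty connected non-crossing partitions: the trees of the forest picture. -/
abbrev Component : Type :=
  {κ : SetPartition // κ ≠ empty ∧ κ.Connected ∧ κ.NonCrossing}

/-- The partition with the given list of components. -/
def assemble (L : List Component) : SetPartition := concat (L.map Subtype.val)

lemma assemble_append (L M : List Component) :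
    assemble (L ++ M) = (assemble L).append (assemble M) := by
  rw [assemble, List.map_append, concat_append]
  rfl

lemma assemble_nil : assemble [] = empty := rfl

lemma assemble_cons (κ : Component) (L : List Component) :
    assemble (κ :: L) = κ.1.append (assemble L) := rfl

lemma isDecomposition_assemble (L : List Component) :
    (assemble L).IsDecomposition (L.map Subtype.val) :=
  ⟨fun _ hx => by
    obtain ⟨κ, -, rfl⟩ := List.mem_map.1 hx
    exact ⟨κ.2.1, κ.2.2.1⟩, rfl⟩

lemma assemble_injective : Function.Injective assemble := fun L M h =>
  List.map_injective_iff.2 Subtype.val_injective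
    ((existsUnique_isDecomposition _).unique (isDecomposition_assemble L)
      (h ▸ isDecomposition_assemble M))

lemma nonCrossing_assemble (L : List Component) : (assemble L).NonCrossing := by
  induction L with
  | nil =>
    rintro ⟨f, -⟩
    exact (f ⟨0, by simp [p1212]⟩).elim0
  | cons κ L ih => exact nonCrossing_append_iff.2 ⟨κ.2.2.2, ih⟩

lemma nonCrossing_of_mem {L : List SetPartition} (h : (concat L).NonCrossing) :
    ∀ κ ∈ L, κ.NonCrossing := by
  induction L with
  | nil => simp
  | cons a L ih =>
    obtain ⟨h1, h2⟩ := nonCrossing_append_iff.1 (show (a.append (concat L)).NonCrossing from h)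
    simpa [h1] using ih h2

lemma exists_assemble_eq {π : SetPartition} (h : π.NonCrossing) : ∃ L, assemble L = π := by
  obtain ⟨L, hL, rfl⟩ := exists_isDecomposition π
  lift L to List Component using fun κ hκ => ⟨(hL κ hκ).1, (hL κ hκ).2, nonCrossing_of_mem h κ hκ⟩
  exact ⟨L, rfl⟩

/-- Non-crossing partitions correspond to their lists of components. -/
noncomputable def assembleEquiv : List Component ≃ {π : SetPartition // π.NonCrossing} :=
  Equiv.ofBijective (fun L => ⟨assemble L, nonCrossing_assemble L⟩)
    ⟨fun _ _ h => assemble_injective (congrArg Subtype.val h), fun π => by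
      obtain ⟨L, hL⟩ := exists_assemble_eq π.2
      exact ⟨L, Subtype.ext hL⟩⟩

lemma numComponents_assemble (L : List Component) : (assemble L).numComponents = L.length := by
  rw [numComponents, (existsUnique_isDecomposition _).unique (isDecomposition_components _)
    (isDecomposition_assemble L), List.length_map]

lemma size_assemble (L : List Component) :
    (assemble L).size = (L.map fun κ => κ.1.size).sum := by
  induction L with
  | nil => rfl
  | cons κ L ih => rw [assemble_cons, size_append, ih, List.map_cons, List.sum_cons]

lemma contains_assemble_iff {τ : SetPartition} (h0 : τ ≠ empty) (hτ : τ.Connected)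
    (L : List Component) : (assemble L).Contains τ ↔ ∃ κ ∈ L, κ.1.Contains τ := by
  induction L with
  | nil =>
    simp only [List.not_mem_nil, false_and, exists_false, iff_false]
    rintro ⟨f, -⟩
    exact (f ⟨0, List.length_pos_iff.2 (ne_empty_iff.1 h0)⟩).elim0
  | cons κ L ih => simp [assemble_cons, contains_append_iff hτ, ih]

/-- Non-crossing partitions correspond to nonempty connected ones through `close`: joining a forest
to a tree. -/
noncomputable def closeEquiv : List Component ≃ Component :=
  Equiv.ofBijective (fun L => ⟨(assemble L).close, close_ne_empty _, connected_close _,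
      nonCrossing_close_iff.2 (nonCrossing_assemble L)⟩)
    ⟨fun _ _ h => assemble_injective (close_injective (congrArg Subtype.val h)), fun κ => by
      obtain ⟨π, hπ, h⟩ := exists_eq_close κ.2.1 κ.2.2.1 κ.2.2.2
      obtain ⟨L, rfl⟩ := exists_assemble_eq hπ
      exact ⟨L, Subtype.ext h.symm⟩⟩

lemma coe_closeEquiv (L : List Component) : (closeEquiv L).1 = (assemble L).close := rfl

lemma contains_closeEquiv {τ : SetPartition} (h0 : τ ≠ empty) (hτ : τ.Connected)
    (X : List Component) (κ : Component) (hκ : κ ∈ X) (h : κ.1.Contains τ) :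
    (closeEquiv X).1.Contains τ :=
  ((contains_assemble_iff h0 hτ X).2 ⟨κ, hκ, h⟩).close

/-- Whether a forest with a given spine contains `σ[ρ]` depends only on the second forests of the
spine: an occurrence exists exactly when their concatenation, from the innermost to the outermost,
contains `ρ`. (The spine stores these forests in reverse, whence the `List.reverse`.) The reason
is that `c` is the first place where `σ` is completed, and the letters after it that may serve in
`ρ` are those of the second forests. -/
lemma contains_append_nest_iff {σ ρ : SetPartition} (h0 : σ ≠ empty) (hσ : σ.Connected)
    {c : Component} (l : List (List Component × List Component)) (V N : List Component)
    (hV : ∀ κ ∈ V, ¬ κ.1.Contains σ)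
    (hl : IsSpine closeEquiv (fun κ => κ.1.Contains σ) (c, l)) :
    (assemble (V ++ nest closeEquiv c l :: N)).Contains (σ.append ρ) ↔
      (assemble ((l.map Prod.snd).flatten.reverse ++ N)).Contains ρ := by
  have hV' : ¬ (assemble V).Contains σ := by simpa [contains_assemble_iff h0 hσ] using hV
  rw [assemble_append, contains_append_append_iff_of_avoids_left hσ hV', assemble_cons]
  clear hV'
  induction l generalizing V N with
  | nil =>
    obtain ⟨X, rfl⟩ := closeEquiv.surjective c
    have hX : ¬ (assemble X).Contains σ := by
      simpa [contains_assemble_iff h0 hσ] using hl.2.1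
    refine ⟨fun h => ?_, fun h => hl.1.append h⟩
    rcases contains_of_contains_close_append h0 h with h | h
    · exact h
    · rw [contains_append_append_iff_of_avoids_left hσ hX] at h
      exact contains_of_contains_append_right h
  | cons y l ih =>
    obtain ⟨V₁, N₁⟩ := y
    have hV₁ : ¬ (assemble V₁).Contains σ := by
      simpa [contains_assemble_iff h0 hσ] using hl.head
    have hin : (assemble (V₁ ++ nest closeEquiv c l :: N₁.reverse)).Contains σ :=
      (contains_assemble_iff h0 hσ _).2
        ⟨_, by simp, hl.tail.nest_mem (contains_closeEquiv h0 hσ)⟩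
    change ((assemble (V₁ ++ nest closeEquiv c l :: N₁.reverse)).close.append _).Contains _ ↔ _
    rw [contains_close_append_iff h0 hin, ← assemble_append, List.append_assoc, List.cons_append,
      assemble_append V₁, contains_append_append_iff_of_avoids_left hσ hV₁, assemble_cons,
      List.map_cons, List.flatten_cons, List.reverse_append, List.append_assoc]
    exact ih V₁ (N₁.reverse ++ N) hl.head hl.tail

/-- The mirror image of `contains_append_nest_iff` for the pattern `ρ[σ]`: here `ρ` has to occur in
the concatenation of the second forests from the outermost to the innermost, which precede `c`. -/
lemma contains_append_nest_reverse_iff {σ ρ : SetPartition} (h0 : σ ≠ empty) (hσ : σ.Connected)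
    {c : Component} (l : List (List Component × List Component)) (V N : List Component)
    (hV : ∀ κ ∈ V, ¬ κ.1.Contains σ)
    (hl : IsSpine closeEquiv (fun κ => κ.1.Contains σ) (c, l)) :
    (assemble (N ++ nest (List.reverse_involutive.toPerm.trans closeEquiv) c l :: V)).Contains
        (ρ.append σ) ↔ (assemble (N ++ (l.map Prod.snd).flatten)).Contains ρ := by
  have hV' : ¬ (assemble V).Contains σ := by simpa [contains_assemble_iff h0 hσ] using hV
  rw [List.append_cons, assemble_append, contains_append_append_iff_of_avoids_right hσ hV',
    assemble_append, assemble_cons, assemble_nil, append_empty]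
  clear hV'
  induction l generalizing V N with
  | nil =>
    obtain ⟨X, rfl⟩ := closeEquiv.surjective c
    have hX : ¬ (assemble X).Contains σ := by
      simpa [contains_assemble_iff h0 hσ] using hl.2.1
    rw [List.map_nil, List.flatten_nil, List.append_nil]
    refine ⟨fun h => ?_, fun h => h.append hl.1⟩
    rcases contains_of_contains_append_close h0 h with h | h
    · exact h
    · rw [contains_append_append_iff_of_avoids_right hσ hX] at h
      exact contains_of_contains_append_left h
  | cons y l ih =>
    obtain ⟨V₁, N₁⟩ := y
    have hV₁ : ¬ (assemble V₁.reverse).Contains σ := by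
      simpa [contains_assemble_iff h0 hσ] using hl.head
    set K := nest (List.reverse_involutive.toPerm.trans closeEquiv) c l with hK
    have hKσ : K.1.Contains σ := (isSpine_reverse.2 hl.tail).nest_mem fun X κ hκ h =>
      contains_closeEquiv h0 hσ _ κ (List.mem_reverse.2 hκ) h
    have hin : (assemble (N₁ ++ K :: V₁.reverse)).Contains σ :=
      (contains_assemble_iff h0 hσ _).2 ⟨K, by simp, hKσ⟩
    have hnest : (nest (List.reverse_involutive.toPerm.trans closeEquiv) c ((V₁, N₁) :: l)).1 =
        (assemble (N₁ ++ K :: V₁.reverse)).close := by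
      rw [← coe_closeEquiv, nest]
      simp [hK]
    rw [hnest, contains_append_close_iff h0 hin, ← assemble_append, ← List.append_assoc,
      List.append_cons, assemble_append _ V₁.reverse,
      contains_append_append_iff_of_avoids_right hσ hV₁, assemble_append, assemble_cons,
      assemble_nil, append_empty, List.map_cons, List.flatten_cons, ← List.append_assoc]
    exact ih V₁ (N ++ N₁) hl.head hl.tail

end SetPartition

end PartitionPattern

open PartitionPattern SetPartition in
theorem mainTheorem7 (σ ρ : PartitionPattern.SetPartition)
    (hσ : σ.NonCrossing) (hρ : ρ.NonCrossing) (hconn : σ.Connected) :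
    (σ.append ρ).CCEquiv (ρ.append σ) := by
  by_cases h0 : σ = empty
  · -- both patterns are then equal to `ρ`
    rw [h0, empty_append, append_empty]
    exact ⟨Equiv.refl _, fun π => ⟨rfl, rfl⟩⟩
  have hp := contains_closeEquiv h0 hconn
  have hsz : ∀ X, (closeEquiv X).1.size = (X.map fun κ => κ.1.size).sum + 1 := fun X => by
    rw [coe_closeEquiv, size_close, size_assemble]
  obtain ⟨e, he, he'⟩ := exists_perm_forest hp (sz := fun κ : Component => κ.1.size) hsz
  have key : ∀ L, (assemble (e L)).size = (assemble L).size ∧ (e L).length = L.length ∧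
      ((assemble L).Contains (σ.append ρ) ↔ (assemble (e L)).Contains (ρ.append σ)) := by
    intro L
    by_cases hL : ∃ κ ∈ L, κ.1.Contains σ
    · obtain ⟨V, K, N, rfl, hV, hK⟩ :=
        exists_append_cons_of_mem (p := fun κ : Component => κ.1.Contains σ) hL
      obtain ⟨⟨c, l⟩, hx, rfl⟩ := exists_nest_eq (cl := closeEquiv)
        (p := fun κ : Component => κ.1.Contains σ) (sz := fun κ => κ.1.size)
        (fun X κ hκ => size_lt_of_mem (sz := fun κ : Component => κ.1.size) hsz hκ) K hK
      obtain ⟨N, rfl⟩ := List.reverse_surjective N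
      dsimp only
      obtain ⟨N', l', hx', hsize, hlen, hflat, heq⟩ := he' c V N l
        ⟨hx.1, hx.2.1, List.forall_mem_cons.2 ⟨hV, hx.2.2⟩⟩
      refine ⟨?_, ?_, ?_⟩
      · rw [size_assemble, size_assemble, hsize]
      · rw [heq]
        simp only [List.length_append, List.length_cons, List.length_reverse, hlen]
        omega
      · rw [heq, contains_append_nest_iff h0 hconn l V _ hV hx,
          contains_append_nest_reverse_iff h0 hconn l' V.reverse N' (by simpa using hV) hx'.tail,
          hflat, List.reverse_append]
    · have hL' : ¬ (assemble L).Contains σ := by rwa [contains_assemble_iff h0 hconn]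
      rw [he L (by simpa using hL)]
      exact ⟨rfl, rfl, fun h => absurd (contains_of_contains_append_left h) hL',
        fun h => absurd (contains_of_contains_append_right h) hL'⟩
  let f := (assembleEquiv.symm.trans e).trans assembleEquiv
  have hf : ∀ π, ∃ L, assemble L = π.1 ∧ assemble (e L) = (f π).1 := fun π =>
    ⟨assembleEquiv.symm π, congrArg Subtype.val (assembleEquiv.apply_symm_apply π), rfl⟩
  refine ⟨(Equiv.subtypeSubtypeEquivSubtypeInter NonCrossing (Avoids · (σ.append ρ))).symm.trans
    ((f.subtypeEquiv (p := fun π => π.1.Avoids (σ.append ρ))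
      (q := fun π => π.1.Avoids (ρ.append σ)) fun π => ?_).trans
      (Equiv.subtypeSubtypeEquivSubtypeInter NonCrossing (Avoids · (ρ.append σ)))), fun π => ?_⟩
  · obtain ⟨L, hL, hL'⟩ := hf π
    rw [Avoids, Avoids, ← hL, ← hL', (key L).2.2]
  · obtain ⟨L, hL, hL'⟩ := hf ⟨π.1, π.2.1⟩
    change (f ⟨π.1, π.2.1⟩).1.size = _ ∧ (f ⟨π.1, π.2.1⟩).1.numComponents = _
    dsimp only at hL
    rw [← hL', ← hL, numComponents_assemble, numComponents_assemble]
    exact ⟨(key L).1, (key L).2.1⟩
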